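/- Fix the field $\mathbb{Q}$. For $N\ge 0$ let $\mathscr{P}_N$ be the algebra over $\mathbb{Q}$ of superpolynomials in commuting variables $x_1,\dots,x_N$ and anticommuting variables $\theta_1,\dots,\theta_N$ (so $\theta_i\theta_j=-\theta_j\theta_i$, $\theta_i^2=0$, and the $x_i$ commute with the $\theta_j$), that is, the Grassmann algebra on $\theta_1,\dots,\theta_N$ over $\mathbb{Q}[x_1,\dots,x_N]$. Let $\mathscr{P}^{S_N}\subseteq\mathscr{P}_N$ be the subalgebra of elements invariant under the diagonal action of the symmetric group $S_N$, $x_i\mapsto x_{\sigma(i)}$, $\theta_i\mapsto\theta_{\sigma(i)}$, and let $\mathscr{P}^{S_N}_{(n|m)}$ be its subspace of elements that are homogeneous of degree $n$ in $x$ and of degree $m$ in $\theta$. Let $\mathscr{P}^{S_\infty}_{(n|m)}$ be the space of symmetric superfunctions of degree $(n|m)$ in infinitely many variables, i.e. the inverse limit of the spaces $\mathscr{P}^{S_N}_{(n|m)}$ under the maps setting $x_{N+1}=\theta_{N+1}=0$, and let $\mathscr{P}^{S_\infty}=\bigoplus_{n,m\ge 0}\mathscr{P}^{S_\infty}_{(n|m)}$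 be the ring of symmetric superfunctions. A superpartition $\Lambda=(\Lambda_1,\dots,\Lambda_m;\Lambda_{m+1},\dots,\Lambda_\ell)$ of $(n|m)$, written $\Lambda\vdash(n|m)$, consists of integers $\Lambda_1>\dots>\Lambda_m\ge 0$ and $\Lambda_{m+1}\ge\dots\ge\Lambda_\ell>0$ with $\Lambda_1+\dots+\Lambda_\ell=n$. Put $$p_k=\sum_i x_i^k\ (k\ge1),\qquad \tilde p_k=\sum_i\theta_i x_i^k\ (k\ge 0),\qquad p_\Lambda=\tilde p_{\Lambda_1}\cdots\tilde p_{\Lambda_m}\,p_{\Lambda_{m+1}}\cdots p_{\Lambda_\ell},$$ where the sums run over $1\le i\le N$ or, for infinitely many variables, over all $i\ge 1$. Then: 1. If either $m=0$ and $n\le N$, or $m>0$ and $n<N$, then $\{p_\Lambda : \Lambda\vdash(n|m)\}$ (in $N$ variables) is a $\mathbb{Q}$-basis of $\mathscr{P}^{S_N}_{(n|m)}$. 2. For all $n,m\ge 0$, $\{p_\Lambda : \Lambda\vdash(n|m)\}$ is a $\mathbb{Q}$-basis of $\mathscr{P}^{S_\infty}_{(n|m)}$. Consequently $\{p_\Lambda\}$,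 with $\Lambda$ running over all superpartitions, is a $\mathbb{Q}$-basis of $\mathscr{P}^{S_\infty}$. Here "basis" means that the $p_\Lambda$, indexed by the superpartitions $\Lambda$, are linearly independent over $\mathbb{Q}$ and span the space. -/

import Mathlib

open scoped TensorProduct

noncomputable section

namespace SymSuper

/-- A superpartition `(Λ^a; Λ^s)`: a strictly decreasing sequence of non-negative integers and an
ordinary partition. As usual, trailing zeros of `Λ^s` are dropped; a zero in `Λ^a` is significant. -/
@[ext]
structure Superpartition where
  anti : List ℕ
  symm : List ℕ
  anti_strict : anti.Pairwise (fun a b => b < a)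
  symm_weak : symm.Pairwise (fun a b => b ≤ a)
  symm_pos : ∀ k ∈ symm, 0 < k

namespace Superpartition

/-- The bosonic degree `|Λ|`. -/
def degree (Λ : Superpartition) : ℕ := Λ.anti.sum + Λ.symm.sum

/-- The fermionic degree (sector) of `Λ`. -/
def sector (Λ : Superpartition) : ℕ := Λ.anti.length

end Superpartition

/-- The superpartitions of `(n|m)`. -/
def SPar (n m : ℕ) : Type := {Λ : Superpartition // Λ.degree = n ∧ Λ.sector = m}

/-- The superpolynomials over `A` in the commuting variables `x_1, …, x_N` and the anticommuting
variables `θ_1, …, θ_N`: the Grassmann algebra on the `θ`s, with coefficients extended from `A` to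
`A[x_1, …, x_N]`. (Elements of the two factors commute with each other.) -/
abbrev SuperPoly (A : Type) [CommRing A] (N : ℕ) : Type :=
  MvPolynomial (Fin N) A ⊗[A] ExteriorAlgebra A (Fin N →₀ A)

variable (A : Type) [CommRing A]

/-- The commuting variable `x_i`. -/
def x {N : ℕ} (i : Fin N) : SuperPoly A N := MvPolynomial.X i ⊗ₜ[A] 1

/-- The anticommuting variable `θ_i`. -/
def theta {N : ℕ} (i : Fin N) : SuperPoly A N :=
  1 ⊗ₜ[A] ExteriorAlgebra.ι A (Finsupp.single i 1)

/-- The diagonal action of a permutation: `x_i ↦ x_{σ i}` and `θ_i ↦ θ_{σ i}` for all `i`. -/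
def permute {N : ℕ} (σ : Equiv.Perm (Fin N)) : SuperPoly A N →ₐ[A] SuperPoly A N :=
  Algebra.TensorProduct.map (MvPolynomial.rename σ)
    (ExteriorAlgebra.map (Finsupp.lmapDomain A A σ))

/-- The algebra of symmetric superpolynomials in `N` variables. -/
def symSuperPoly (N : ℕ) : Subalgebra A (SuperPoly A N) :=
  ⨅ σ : Equiv.Perm (Fin N), AlgHom.equalizer (permute A σ) (AlgHom.id A _)

/-- The superpolynomials that are homogeneous of degree `n` in `x` and of degree `m` in `θ`. -/
def homogeneous (N n m : ℕ) : Submodule A (SuperPoly A N) :=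
  Submodule.map₂ (TensorProduct.mk A _ _)
    (MvPolynomial.homogeneousSubmodule (Fin N) A n) (⋀[A]^m (Fin N →₀ A))

/-- The symmetric superpolynomials of degree `(n|m)` in `N` variables. -/
def symHomogeneous (N n m : ℕ) : Submodule A (SuperPoly A N) :=
  (symSuperPoly A N).toSubmodule ⊓ homogeneous A N n m

/-- Restriction from `N + 1` to `N` variables: set `x_{N+1} = θ_{N+1} = 0`. -/
def restrict (N : ℕ) : SuperPoly A (N + 1) →ₐ[A] SuperPoly A N :=
  Algebra.TensorProduct.map (MvPolynomial.aeval (Fin.lastCases 0 MvPolynomial.X))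
    (ExteriorAlgebra.map (Finsupp.linearCombination A
      (Fin.lastCases 0 fun i : Fin N => Finsupp.single i (1 : A))))

/-- The symmetric superfunctions of degree `(n|m)` in infinitely many variables. Such a formal
infinite sum of monomials is given by its truncations to `N` variables, for all `N`, so these are
the elements of the inverse limit of the spaces of symmetric superpolynomials of degree `(n|m)` in
`N` variables along the restriction maps. -/
def symFunHomogeneous (n m : ℕ) : Submodule A (∀ N, SuperPoly A N) where
  carrier := {f | (∀ N, f N ∈ symHomogeneous A N n m) ∧ ∀ N, restrict A N (f (N + 1)) = f N}
  add_mem' {f g} hf hg :=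
    ⟨fun N => add_mem (hf.1 N) (hg.1 N), fun N => by simp [hf.2 N, hg.2 N]⟩
  zero_mem' := ⟨fun N => zero_mem _, fun N => by simp⟩
  smul_mem' c f hf :=
    ⟨fun N => Submodule.smul_mem _ c (hf.1 N), fun N => by simp [hf.2 N]⟩

theorem homogeneous_one (N : ℕ) : (1 : SuperPoly A N) ∈ homogeneous A N 0 0 := by
  rw [Algebra.TensorProduct.one_def]
  exact Submodule.apply_mem_map₂ _ (MvPolynomial.isHomogeneous_one _ _)
    (SetLike.GradedOne.one_mem (A := fun i : ℕ => ⋀[A]^i (Fin N →₀ A)))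

theorem homogeneous_mul {N n m n' m' : ℕ} {f g : SuperPoly A N}
    (hf : f ∈ homogeneous A N n m) (hg : g ∈ homogeneous A N n' m') :
    f * g ∈ homogeneous A N (n + n') (m + m') := by
  have key : homogeneous A N n m ≤ (Submodule.comap
      ((LinearMap.mul A (SuperPoly A N)).flip g) (homogeneous A N (n + n') (m + m'))) := by
    refine Submodule.map₂_le.2 fun p hp w hw => ?_
    have key' : homogeneous A N n' m' ≤ (Submodule.comap
        (LinearMap.mul A (SuperPoly A N) (p ⊗ₜ w)) (homogeneous A N (n + n') (m + m'))) := by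
      refine Submodule.map₂_le.2 fun p' hp' w' hw' => ?_
      have h := Submodule.apply_mem_map₂ (TensorProduct.mk A _ _)
        (show p * p' ∈ MvPolynomial.homogeneousSubmodule (Fin N) A (n + n') from
          MvPolynomial.IsHomogeneous.mul hp hp')
        (SetLike.mul_mem_graded (A := fun i : ℕ => ⋀[A]^i (Fin N →₀ A)) hw hw')
      simpa [homogeneous] using h
    exact key' hg
  exact key hf

theorem symFunHomogeneous_one : (1 : ∀ N, SuperPoly A N) ∈ symFunHomogeneous A 0 0 :=
  ⟨fun N => ⟨one_mem (symSuperPoly A N), homogeneous_one A N⟩, fun N => map_one (restrict A N)⟩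

theorem symFunHomogeneous_mul {n m n' m' : ℕ} {f g : ∀ N, SuperPoly A N}
    (hf : f ∈ symFunHomogeneous A n m) (hg : g ∈ symFunHomogeneous A n' m') :
    f * g ∈ symFunHomogeneous A (n + n') (m + m') :=
  ⟨fun N => ⟨mul_mem (S := Subalgebra A (SuperPoly A N)) (hf.1 N).1 (hg.1 N).1,
      homogeneous_mul A (hf.1 N).2 (hg.1 N).2⟩,
    fun N => by rw [Pi.mul_apply, Pi.mul_apply, map_mul, hf.2 N, hg.2 N]⟩

/-- The ring of symmetric superfunctions in infinitely many variables: the finite sums of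
homogeneous symmetric superfunctions of arbitrary degrees, with the product of superpolynomials. -/
def symFun : Subalgebra A (∀ N, SuperPoly A N) :=
  Submodule.toSubalgebra (⨆ d : ℕ × ℕ, symFunHomogeneous A d.1 d.2)
    (Submodule.mem_iSup_of_mem (0, 0) (symFunHomogeneous_one A))
    (fun f g hf hg => by
      induction hf using Submodule.iSup_induction' with
      | mem d f hf =>
        induction hg using Submodule.iSup_induction' with
        | mem e g hg =>
          exact Submodule.mem_iSup_of_mem (d + e) (symFunHomogeneous_mul A hf hg)
        | zero => rw [mul_zero]; exact zero_mem _
        | add g g' _ _ h h' => rw [mul_add]; exact add_mem h h'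
      | zero => rw [zero_mul]; exact zero_mem _
      | add f f' _ _ h h' => rw [add_mul]; exact add_mem h h')

/-- The bosonic power sum `p_n = ∑ x_i ^ n` in `N` variables; it is used for `n ≥ 1` only. -/
def powerSum (N n : ℕ) : SuperPoly A N := ∑ i : Fin N, x A i ^ n

/-- The fermionic power sum `∑ θ_i x_i ^ n` in `N` variables, for `n ≥ 0`. -/
def fermionicPowerSum (N n : ℕ) : SuperPoly A N := ∑ i : Fin N, theta A i * x A i ^ n

/-- The power-sum superpolynomial `p_Λ` in `N` variables. The product is taken from left to right. -/
def superPowerSum (N : ℕ) (Λ : Superpartition) : SuperPoly A N :=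
  (Λ.anti.map (fermionicPowerSum A N)).prod * (Λ.symm.map (powerSum A N)).prod

/-- The power-sum superfunction `p_Λ` in infinitely many variables, given by its truncations. -/
def superPowerSumInf (Λ : Superpartition) : ∀ N, SuperPoly A N := fun N => superPowerSum A N Λ

end SymSuper

end

open scoped TensorProduct

noncomputable section

namespace SymSuper

variable (A : Type) [CommRing A]

variable {N : ℕ}

/-! Spanning is a symmetrization argument. A monomial is a word in letters `θ_i^e x_i^a`, and
letters commute up to a sign depending only on their exponents. For symmetric `f`, the sum of all
its permuted copies is `N! f`, so in characteristic 0 it suffices to treat the symmetrization of a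
word, which is a sum over injective index maps. Inclusion-exclusion on one index at a time
(`sum_word_mem`) turns such a sum into a polynomial in the power sums `∑ θ_i^e x_i^a`. These
products are then sorted into multiples of `p_Λ` (`letterSum_mul_superPowerSum_mem`). This works for
every `N`.

Independence is a dimension count. If every superpartition of `(n|m)` has at most `N` parts, which
is what the bound on `n` ensures, the symmetrized monomials `symMonomial` are independent, so the
space has dimension at least the number of superpartitions; a spanning family of that size is
independent (`linearIndependent_superPowerSum`).

In infinitely many variables, independence at `n + 1` variables gives independence in the limit and
makes the coefficients of an element stable in `N`. A projection to each bidegree separates the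
different `(n|m)`. -/

/-! ### Sign rules for letters and words -/

theorem theta_mul_self (i : Fin N) : theta A i * theta A i = 0 := by
  simp [theta]

theorem theta_mul_comm (i j : Fin N) :
    theta A i * theta A j = (-1 : A) • (theta A j * theta A i) := by
  have h := ExteriorAlgebra.ι_add_mul_swap (R := A) (Finsupp.single i (1 : A))
    (Finsupp.single j (1 : A))
  simp only [theta, Algebra.TensorProduct.tmul_mul_tmul, mul_one]
  rw [eq_neg_of_add_eq_zero_left h, ← neg_one_smul A, TensorProduct.tmul_smul]

theorem tmul_one_commute (p : MvPolynomial (Fin N) A) (f : SuperPoly A N) :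
    Commute (p ⊗ₜ[A] 1) f := by
  induction f using TensorProduct.induction_on with
  | zero => exact Commute.zero_right _
  | tmul q w => simp [Commute, SemiconjBy, mul_comm]
  | add f g hf hg => exact hf.add_right hg

theorem x_commute (i : Fin N) (f : SuperPoly A N) : Commute (x A i) f :=
  tmul_one_commute A _ f

/-- The superpolynomial `θ_i ^ s.2 * x_i ^ s.1`. -/
def letter (s : ℕ × ℕ) (i : Fin N) : SuperPoly A N := theta A i ^ s.2 * x A i ^ s.1

@[simp] theorem letter_zero (i : Fin N) : letter A 0 i = 1 := by simp [letter]

theorem letter_mul_letter (s t : ℕ × ℕ) (i : Fin N) :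
    letter A s i * letter A t i = letter A (s + t) i := by
  simp only [letter, Prod.fst_add, Prod.snd_add, pow_add]
  rw [mul_assoc, ← mul_assoc (x A i ^ s.1),
    ((x_commute A i (theta A i ^ t.2)).pow_left s.1).eq]
  simp only [mul_assoc]

theorem theta_mul_theta_pow (i j : Fin N) (b : ℕ) :
    theta A i * theta A j ^ b = (-1 : A) ^ b • (theta A j ^ b * theta A i) := by
  induction b with
  | zero => simp
  | succ b ih =>
    rw [pow_succ, ← mul_assoc, ih, smul_mul_assoc, mul_assoc, theta_mul_comm A i j,
      mul_smul_comm, smul_smul, ← pow_succ, ← mul_assoc, ← pow_succ]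

theorem theta_pow_mul_theta_pow (i j : Fin N) (a b : ℕ) :
    theta A i ^ a * theta A j ^ b = (-1 : A) ^ (a * b) • (theta A j ^ b * theta A i ^ a) := by
  induction a with
  | zero => simp
  | succ a ih =>
    rw [pow_succ, mul_assoc, theta_mul_theta_pow, mul_smul_comm, ← mul_assoc, ih,
      smul_mul_assoc, smul_smul, mul_assoc]
    congr 1
    ring

theorem letter_mul_comm (s t : ℕ × ℕ) (i j : Fin N) :
    letter A s i * letter A t j = (-1 : A) ^ (s.2 * t.2) • (letter A t j * letter A s i) := by
  have h (i j : Fin N) (s t : ℕ × ℕ) : letter A s i * letter A t j =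
      theta A i ^ s.2 * theta A j ^ t.2 * (x A i ^ s.1 * x A j ^ t.1) := by
    simp only [letter]
    rw [mul_assoc, ← mul_assoc (x A i ^ s.1),
      ((x_commute A i (theta A j ^ t.2)).pow_left s.1).eq]
    simp only [mul_assoc]
  rw [h, h, theta_pow_mul_theta_pow, smul_mul_assoc,
    (((x_commute A i (x A j ^ t.1)).pow_left s.1)).eq]

/-- The product `u_{t 0}(f 0) ⋯ u_{t (k-1)}(f (k-1))` with `u_s(i) = θ_i ^ s.2 * x_i ^ s.1`. -/
def word {k : ℕ} (t : Fin k → ℕ × ℕ) (f : Fin k → Fin N) : SuperPoly A N :=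
  (List.ofFn fun j => letter A (t j) (f j)).prod

theorem word_succ {k : ℕ} (t : Fin (k + 1) → ℕ × ℕ) (f : Fin (k + 1) → Fin N) :
    word A t f = letter A (t 0) (f 0) * word A (fun j => t j.succ) (fun j => f j.succ) := by
  simp [word]

/-- The new letter is moved past the first `j` letters and merged with the one that has the same
index. The sign `c` does not depend on `f`, so it can be taken out of sums over `f`. -/
theorem letter_mul_word {k : ℕ} (s : ℕ × ℕ) (t : Fin k → ℕ × ℕ) (j : Fin k) :
    ∃ c : A, ∀ f : Fin k → Fin N,
      letter A s (f j) * word A t f = c • word A (t + Pi.single j s) f := by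
  induction k with
  | zero => exact j.elim0
  | succ k ih =>
    induction j using Fin.cases with
    | zero =>
      refine ⟨1, fun f => ?_⟩
      rw [word_succ, word_succ, ← mul_assoc, letter_mul_letter, one_smul]
      congr 2
      simp [add_comm]
    | succ j =>
      obtain ⟨c, hc⟩ := ih (fun j => t j.succ) j
      refine ⟨(-1) ^ (s.2 * (t 0).2) * c, fun f => ?_⟩
      rw [word_succ, word_succ, ← mul_assoc, letter_mul_comm, smul_mul_assoc, mul_assoc,
        hc fun j => f j.succ, mul_smul_comm, smul_smul]
      congr 3
      funext i
      simp [Pi.single_apply]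

/-! ### Sums of words over injective index maps -/

/-- The power sum `∑ θ_i ^ s.2 * x_i ^ s.1`. -/
def letterSum (N : ℕ) (s : ℕ × ℕ) : SuperPoly A N := ∑ i : Fin N, letter A s i

/-- The span of the products of power sums of total degree `d`. -/
def letterSumSpan (N : ℕ) (d : ℕ × ℕ) : Submodule A (SuperPoly A N) :=
  Submodule.span A {g | ∃ l : List (ℕ × ℕ), l.sum = d ∧ g = (l.map (letterSum A N)).prod}

theorem letterSum_mul_mem {d : ℕ × ℕ} (s : ℕ × ℕ) {g : SuperPoly A N}
    (hg : g ∈ letterSumSpan A N d) : letterSum A N s * g ∈ letterSumSpan A N (s + d) := by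
  induction hg using Submodule.span_induction with
  | mem g hg =>
    obtain ⟨l, rfl, rfl⟩ := hg
    exact Submodule.subset_span ⟨s :: l, by simp, by simp⟩
  | zero => simp
  | add f g _ _ hf hg => rw [mul_add]; exact add_mem hf hg
  | smul c f _ hf => rw [mul_smul_comm]; exact Submodule.smul_mem _ _ hf

/-- Induction on the length: the first index runs over all values minus those taken by the tail. The
unrestricted sum factors off a power sum; each collision merges the first letter into the tail,
leaving a shorter word of the same total degree. -/
theorem sum_word_mem {k : ℕ} (t : Fin k → ℕ × ℕ) :
    ∑ f : Fin k ↪ Fin N, word A t f ∈ letterSumSpan A N (∑ j, t j) := by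
  induction k with
  | zero =>
    refine Submodule.subset_span ⟨[], by simp, ?_⟩
    simp [word]
  | succ k ih =>
    choose c hc using fun j => letter_mul_word A (N := N) (t 0) (fun j => t j.succ) j
    have key : ∑ f : Fin (k + 1) ↪ Fin N, word A t f =
        letterSum A N (t 0) * ∑ f : Fin k ↪ Fin N, word A (fun j => t j.succ) f -
          ∑ j, c j • ∑ f : Fin k ↪ Fin N, word A ((fun j => t j.succ) + Pi.single j (t 0)) f := by
      classical
      -- An embedding of `Fin (k + 1)` is an embedding of the tail together with a value outside its
      -- range.
      rw [← (Equiv.embeddingFinSucc k (Fin N)).symm.sum_comp, Fintype.sum_sigma, Finset.mul_sum]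
      simp_rw [Finset.smul_sum]
      rw [Finset.sum_comm, ← Finset.sum_sub_distrib]
      refine Finset.sum_congr rfl fun f _ => ?_
      rw [eq_sub_iff_add_eq]
      simp_rw [← hc]
      rw [← Finset.sum_mul, letterSum]
      simp_rw [word_succ A t, Equiv.coe_embeddingFinSucc_symm, Fin.cons_zero, Fin.cons_succ]
      rw [← Finset.sum_mul, ← add_mul]
      congr 1
      rw [← Finset.sum_map Finset.univ f (letter A (t 0))]
      rw [← Finset.sum_subtype (Finset.univ \ Finset.univ.map f) (by simp) (letter A (t 0))]
      exact Finset.sum_sdiff (Finset.subset_univ _)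
    rw [key, Fin.sum_univ_succ]
    refine sub_mem (letterSum_mul_mem A _ (ih _)) (sum_mem fun j _ => Submodule.smul_mem _ _ ?_)
    have h := ih ((fun j => t j.succ) + Pi.single j (t 0))
    simp only [Pi.add_apply, Finset.sum_add_distrib, Finset.sum_pi_single', Finset.mem_univ,
      if_true] at h
    rwa [add_comm] at h

/-! ### Symmetrization of monomials -/

theorem permute_x (σ : Equiv.Perm (Fin N)) (i : Fin N) : permute A σ (x A i) = x A (σ i) := by
  simp [permute, x]

theorem permute_theta (σ : Equiv.Perm (Fin N)) (i : Fin N) :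
    permute A σ (theta A i) = theta A (σ i) := by
  simp [permute, theta, Finsupp.lmapDomain_apply]

theorem permute_letter (σ : Equiv.Perm (Fin N)) (s : ℕ × ℕ) (i : Fin N) :
    permute A σ (letter A s i) = letter A s (σ i) := by
  simp [letter, permute_x, permute_theta]

theorem permute_word (σ : Equiv.Perm (Fin N)) {k : ℕ} (t : Fin k → ℕ × ℕ) (f : Fin k → Fin N) :
    permute A σ (word A t f) = word A t (σ ∘ f) := by
  simp [word, map_list_prod, List.map_ofFn, Function.comp_def, permute_letter]

/-- The span of the monomials of degree `d`, written as words in which every index occurs once. -/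
def wordSpan (N : ℕ) (d : ℕ × ℕ) : Submodule A (SuperPoly A N) :=
  Submodule.span A {g | ∃ t : Fin N → ℕ × ℕ, ∑ i, t i = d ∧ g = word A t id}

theorem letter_mul_mem_wordSpan {d : ℕ × ℕ} (s : ℕ × ℕ) (i : Fin N) {g : SuperPoly A N}
    (hg : g ∈ wordSpan A N d) : letter A s i * g ∈ wordSpan A N (s + d) := by
  induction hg using Submodule.span_induction with
  | mem g hg =>
    obtain ⟨t, rfl, rfl⟩ := hg
    obtain ⟨c, hc⟩ := letter_mul_word A (N := N) s t i
    have := hc id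
    rw [id_eq] at this
    rw [this]
    refine Submodule.smul_mem _ _ (Submodule.subset_span ⟨_, ?_, rfl⟩)
    simp [Finset.sum_add_distrib, add_comm]
  | zero => simp
  | add f g _ _ hf hg => rw [mul_add]; exact add_mem hf hg
  | smul c f _ hf => rw [mul_smul_comm]; exact Submodule.smul_mem _ _ hf

theorem one_mem_wordSpan : (1 : SuperPoly A N) ∈ wordSpan A N 0 :=
  Submodule.subset_span ⟨0, by simp, by simp [word]⟩

/-- Built up by multiplying letters on the left. Repetitions in `g` do no harm, since `wordSpan`
admits exponents of `θ` above 1, whose words vanish. -/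
theorem tmul_mem_wordSpan {m : ℕ} (a : Fin N →₀ ℕ) (g : Fin m → Fin N) :
    MvPolynomial.monomial a (1 : A) ⊗ₜ[A]
      ExteriorAlgebra.ιMulti A m (fun j => Finsupp.single (g j) (1 : A)) ∈
      wordSpan A N (a.degree, m) := by
  induction a using Finsupp.induction with
  | zero =>
    induction m with
    | zero =>
      simpa [← Algebra.TensorProduct.one_def, ← Prod.zero_eq_mk] using one_mem_wordSpan A (N := N)
    | succ m ih =>
      have h := letter_mul_mem_wordSpan A (0, 1) (g 0) (ih fun j => g j.succ)
      rw [Prod.mk_add_mk, zero_add, add_comm 1] at h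
      convert h using 1
      rw [ExteriorAlgebra.ιMulti_succ_apply]
      simp [letter, theta, Matrix.vecTail, Function.comp_def]
  | single_add i b a _ _ ih =>
    have h := letter_mul_mem_wordSpan A (b, 0) i ih
    rw [Prod.mk_add_mk, zero_add] at h
    convert h using 2
    · rw [map_add, Finsupp.degree_single]
    · simp only [letter, x, pow_zero, one_mul, Algebra.TensorProduct.tmul_pow, one_pow,
        Algebra.TensorProduct.tmul_mul_tmul]
      rw [MvPolynomial.X_pow_eq_monomial, MvPolynomial.monomial_mul, one_mul]

theorem homogeneous_eq_span (N n m : ℕ) : homogeneous A N n m = Submodule.span A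
    {f | ∃ (a : Fin N →₀ ℕ) (g : Fin m → Fin N), a.degree = n ∧
      f = MvPolynomial.monomial a (1 : A) ⊗ₜ[A]
        ExteriorAlgebra.ιMulti A m (fun j => Finsupp.single (g j) (1 : A))} := by
  have h1 : MvPolynomial.homogeneousSubmodule (Fin N) A n = Submodule.span A
      ((fun a => MvPolynomial.monomial a (1 : A)) '' {a : Fin N →₀ ℕ | a.degree = n}) := by
    rw [MvPolynomial.homogeneousSubmodule_eq_finsupp_supported]
    exact AddMonoidAlgebra.supported_eq_span_single A _
  have h2 : ⋀[A]^m (Fin N →₀ A) = Submodule.span A (Set.range fun g : Fin m → Fin N =>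
      ExteriorAlgebra.ιMulti A m (fun j => Finsupp.single (g j) (1 : A))) := by
    rw [← exteriorPower.ιMulti_span_fixedDegree_of_span_eq_top A m
      (s := Set.range fun i : Fin N => Finsupp.single i (1 : A))]
    · congr 1
      ext w
      constructor
      · rintro ⟨v, hv, rfl⟩
        choose g hg using fun j => hv ⟨j, rfl⟩
        exact ⟨g, by simp only [hg]⟩
      · rintro ⟨g, rfl⟩
        exact ⟨_, by rintro _ ⟨j, rfl⟩; exact ⟨g j, rfl⟩, rfl⟩
    · exact (Finsupp.basisSingleOne (R := A) (ι := Fin N)).span_eq ▸ by simp [Finsupp.coe_basisSingleOne]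
  rw [homogeneous, h1, h2, Submodule.map₂_span_span]
  congr 1
  ext f
  constructor
  · rintro ⟨_, ⟨a, ha, rfl⟩, _, ⟨g, rfl⟩, rfl⟩
    exact ⟨a, g, ha, rfl⟩
  · rintro ⟨a, g, ha, rfl⟩
    exact ⟨_, ⟨a, ha, rfl⟩, _, ⟨g, rfl⟩, rfl⟩

theorem homogeneous_le_wordSpan (N n m : ℕ) : homogeneous A N n m ≤ wordSpan A N (n, m) := by
  rw [homogeneous_eq_span, Submodule.span_le]
  rintro _ ⟨a, g, rfl, rfl⟩
  exact tmul_mem_wordSpan A a g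

theorem sum_permute_mem {d : ℕ × ℕ} {f : SuperPoly A N} (hf : f ∈ wordSpan A N d) :
    ∑ σ : Equiv.Perm (Fin N), permute A σ f ∈ letterSumSpan A N d := by
  induction hf using Submodule.span_induction with
  | mem f hf =>
    obtain ⟨t, rfl, rfl⟩ := hf
    have h := sum_word_mem A (N := N) t
    -- Self-embeddings of a finite set are its permutations.
    rw [← (Equiv.embeddingEquivOfFinite (Fin N)).symm.sum_comp] at h
    simpa only [permute_word] using! h
  | zero => simp
  | add f g _ _ hf hg => simpa [Finset.sum_add_distrib] using add_mem hf hg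
  | smul c f _ hf => simpa [← Finset.smul_sum] using Submodule.smul_mem _ c hf

theorem mem_symSuperPoly {f : SuperPoly A N} :
    f ∈ symSuperPoly A N ↔ ∀ σ, permute A σ f = f := by
  simp [symSuperPoly, Algebra.mem_iInf, AlgHom.mem_equalizer]

theorem symHomogeneous_le_letterSumSpan (K : Type) [Field K] [CharZero K] (N n m : ℕ) :
    symHomogeneous K N n m ≤ letterSumSpan K N (n, m) := by
  rintro f ⟨hs, hf⟩
  have h := sum_permute_mem K (homogeneous_le_wordSpan K N n m hf)
  have hs' := (mem_symSuperPoly K).1 hs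
  simp only [hs', Finset.sum_const, Finset.card_univ] at h
  rw [← Nat.cast_smul_eq_nsmul K] at h
  exact (Submodule.smul_mem_iff _ (by simp [Fintype.card_ne_zero])).1 h


/-! ### Sorting products of power sums into `p_Λ` -/

theorem letterSum_even (N a : ℕ) : letterSum A N (a, 0) = powerSum A N a := by
  simp [letterSum, letter, powerSum]

theorem letterSum_odd (N a : ℕ) : letterSum A N (a, 1) = fermionicPowerSum A N a := by
  simp [letterSum, letter, fermionicPowerSum]

theorem letterSum_eq_zero (N a e : ℕ) : letterSum A N (a, e + 2) = 0 := by
  simp [letterSum, letter, pow_add, pow_two, theta_mul_self]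

theorem letterSum_mul_comm (s t : ℕ × ℕ) : letterSum A N s * letterSum A N t =
    (-1 : A) ^ (s.2 * t.2) • (letterSum A N t * letterSum A N s) := by
  simp only [letterSum, Finset.sum_mul_sum, Finset.smul_sum]
  rw [Finset.sum_comm]
  simp_rw [letter_mul_comm A s t]

theorem powerSum_commute (a : ℕ) (f : SuperPoly A N) : Commute (powerSum A N a) f :=
  Commute.sum_left _ _ _ fun i _ => (x_commute A i f).pow_left a

theorem fermionicPowerSum_mul_comm (a b : ℕ) :
    fermionicPowerSum A N a * fermionicPowerSum A N b =
      (-1 : A) • (fermionicPowerSum A N b * fermionicPowerSum A N a) := by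
  simpa [letterSum_odd] using letterSum_mul_comm A (N := N) (a, 1) (b, 1)

theorem fermionicPowerSum_mul_prod (a : ℕ) (l : List ℕ) : ∃ c : A,
    fermionicPowerSum A N a * (l.map (fermionicPowerSum A N)).prod =
      c • ((l.orderedInsert (· ≥ ·) a).map (fermionicPowerSum A N)).prod := by
  induction l with
  | nil => exact ⟨1, by simp⟩
  | cons b l ih =>
    obtain ⟨c, hc⟩ := ih
    by_cases h : b ≤ a
    · exact ⟨1, by simp [h]⟩
    · refine ⟨-1 * c, ?_⟩
      rw [List.map_cons, List.prod_cons, ← mul_assoc, fermionicPowerSum_mul_comm,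
        smul_mul_assoc, mul_assoc, hc, mul_smul_comm, smul_smul,
        List.orderedInsert_of_not_le (· ≥ ·) l h, List.map_cons, List.prod_cons]

theorem fermionicPowerSum_mul_prod_eq_zero (K : Type) [Field K] [CharZero K] {a : ℕ} {l : List ℕ}
    (h : a ∈ l) :
    fermionicPowerSum K N a * (l.map (fermionicPowerSum K N)).prod = 0 := by
  induction l with
  | nil => simp at h
  | cons b l ih =>
    rw [List.map_cons, List.prod_cons, ← mul_assoc]
    rcases List.mem_cons.1 h with rfl | h
    · have h := fermionicPowerSum_mul_comm K (N := N) a a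
      generalize fermionicPowerSum K N a * fermionicPowerSum K N a = f at h ⊢
      -- Anticommutation only gives `f = -f` for the square `f`, so 2 must be invertible.
      have h2 : (2 : K) • f = 0 := calc
        (2 : K) • f = (-1 : K) • f + (1 : K) • f := by rw [← h, one_smul, two_smul]
        _ = 0 := by rw [← add_smul, neg_add_cancel, zero_smul]
      rw [(smul_eq_zero_iff_right two_ne_zero).1 h2, zero_mul]
    · rw [fermionicPowerSum_mul_comm, smul_mul_assoc, mul_assoc, ih h, mul_zero, smul_zero]

theorem powerSum_mul_prod (a : ℕ) (l : List ℕ) :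
    powerSum A N a * (l.map (powerSum A N)).prod =
      ((l.orderedInsert (· ≥ ·) a).map (powerSum A N)).prod := by
  rw [← List.prod_cons, ← List.map_cons]
  refine (List.Perm.prod_eq' ((List.perm_orderedInsert _ a l).map _) ?_).symm
  exact (List.pairwise_map.2 (List.pairwise_of_forall fun b _ => powerSum_commute A b _))

/-- The span of the `p_Λ`, with `Λ` running over the superpartitions of `d`. -/
def superPowerSumSpan (N : ℕ) (d : ℕ × ℕ) : Submodule A (SuperPoly A N) :=
  Submodule.span A (Set.range fun Λ : SPar d.1 d.2 => superPowerSum A N Λ.1)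

theorem superPowerSum_mem_span (Λ : Superpartition) {d : ℕ × ℕ}
    (h : Λ.degree = d.1 ∧ Λ.sector = d.2) : superPowerSum A N Λ ∈ superPowerSumSpan A N d :=
  Submodule.subset_span ⟨⟨Λ, h⟩, rfl⟩

theorem letterSum_mul_superPowerSum_mem (K : Type) [Field K] [CharZero K] (Λ : Superpartition)
    (s : ℕ × ℕ) : letterSum K N s * superPowerSum K N Λ ∈
      superPowerSumSpan K N (s + (Λ.degree, Λ.sector)) := by
  obtain ⟨a, e⟩ := s
  match e with
  | 0 =>
    rcases Nat.eq_zero_or_pos a with rfl | ha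
    · rw [letterSum_even]
      -- Indices absent from a monomial contribute the letter 1, whose sum is the scalar `N`.
      have h : powerSum K N 0 = (N : K) • 1 := by
        simp [powerSum, Nat.cast_smul_eq_nsmul]
      rw [h, smul_mul_assoc, one_mul]
      exact Submodule.smul_mem _ _ (superPowerSum_mem_span K Λ (by simp))
    · rw [letterSum_even, superPowerSum, ← mul_assoc, (powerSum_commute K a _).eq, mul_assoc,
        powerSum_mul_prod]
      refine superPowerSum_mem_span K ⟨Λ.anti, Λ.symm.orderedInsert (· ≥ ·) a, Λ.anti_strict,
        List.Pairwise.orderedInsert a _ Λ.symm_weak, fun k hk => ?_⟩ ⟨?_, ?_⟩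
      · rcases List.mem_orderedInsert _ |>.1 hk with rfl | hk
        exacts [ha, Λ.symm_pos k hk]
      · have := (List.perm_orderedInsert (· ≥ ·) a Λ.symm).sum_eq
        simp only [Superpartition.degree, this, List.sum_cons, Prod.fst_add]
        ring
      · simp [Superpartition.sector]
  | 1 =>
    rw [letterSum_odd, superPowerSum, ← mul_assoc]
    by_cases ha : a ∈ Λ.anti
    · rw [fermionicPowerSum_mul_prod_eq_zero K ha, zero_mul]
      exact zero_mem _
    · obtain ⟨c, hc⟩ := fermionicPowerSum_mul_prod K (N := N) a Λ.anti
      rw [hc, smul_mul_assoc]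
      have hperm := List.perm_orderedInsert (· ≥ ·) a Λ.anti
      have hnodup : (Λ.anti.orderedInsert (· ≥ ·) a).Nodup := by
        rw [hperm.nodup_iff, List.nodup_cons]
        exact ⟨ha, Λ.anti_strict.imp fun h => h.ne'⟩
      have hweak : (Λ.anti.orderedInsert (· ≥ ·) a).Pairwise (· ≥ ·) :=
        List.Pairwise.orderedInsert a _ (Λ.anti_strict.imp fun h => h.le)
      refine Submodule.smul_mem _ _ (superPowerSum_mem_span K
        ⟨Λ.anti.orderedInsert (· ≥ ·) a, Λ.symm, ?_, Λ.symm_weak, Λ.symm_pos⟩ ⟨?_, ?_⟩)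
      · exact (hweak.and hnodup).imp fun h => lt_of_le_of_ne h.1 h.2.symm
      · simp only [Superpartition.degree, hperm.sum_eq, List.sum_cons, Prod.fst_add]
        ring
      · simp [Superpartition.sector, List.orderedInsert_length, add_comm]
  | e + 2 =>
    rw [letterSum_eq_zero, zero_mul]
    exact zero_mem _

theorem letterSumSpan_le_superPowerSumSpan (K : Type) [Field K] [CharZero K] (N : ℕ) (d : ℕ × ℕ) :
    letterSumSpan K N d ≤ superPowerSumSpan K N d := by
  refine Submodule.span_le.2 ?_
  rintro _ ⟨l, rfl, rfl⟩
  induction l with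
  | nil =>
    have h := superPowerSum_mem_span K (N := N) ⟨[], [], by simp, by simp, by simp⟩
      (d := 0) (by simp [Superpartition.degree, Superpartition.sector])
    simpa [superPowerSum] using h
  | cons s l ih =>
    rw [List.map_cons, List.prod_cons, List.sum_cons]
    generalize (l.map (letterSum K N)).prod = g at ih
    induction ih using Submodule.span_induction with
    | mem g hg =>
      obtain ⟨⟨Λ, h⟩, rfl⟩ := hg
      have := letterSum_mul_superPowerSum_mem K (N := N) Λ s
      rwa [h.1, h.2] at this
    | zero => simp
    | add f g _ _ hf hg => rw [mul_add]; exact add_mem hf hg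
    | smul c f _ hf => rw [mul_smul_comm]; exact Submodule.smul_mem _ _ hf

/-! ### Symmetry and homogeneity of `p_Λ` -/

theorem permute_powerSum (σ : Equiv.Perm (Fin N)) (a : ℕ) :
    permute A σ (powerSum A N a) = powerSum A N a := by
  simp only [powerSum, map_sum, map_pow, permute_x]
  exact Equiv.sum_comp σ fun i => x A i ^ a

theorem permute_fermionicPowerSum (σ : Equiv.Perm (Fin N)) (a : ℕ) :
    permute A σ (fermionicPowerSum A N a) = fermionicPowerSum A N a := by
  simp only [fermionicPowerSum, map_sum, map_mul, map_pow, permute_x, permute_theta]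
  exact Equiv.sum_comp σ fun i => theta A i * x A i ^ a

theorem permute_superPowerSum (σ : Equiv.Perm (Fin N)) (Λ : Superpartition) :
    permute A σ (superPowerSum A N Λ) = superPowerSum A N Λ := by
  simp only [superPowerSum, map_mul, map_list_prod, List.map_map, Function.comp_def,
    permute_powerSum, permute_fermionicPowerSum]

theorem x_pow_mem_homogeneous (i : Fin N) (a : ℕ) : x A i ^ a ∈ homogeneous A N a 0 := by
  rw [x, Algebra.TensorProduct.tmul_pow, one_pow]
  exact Submodule.apply_mem_map₂ _ (MvPolynomial.isHomogeneous_X_pow i a)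
    (SetLike.GradedOne.one_mem (A := fun i : ℕ => ⋀[A]^i (Fin N →₀ A)))

theorem theta_mem_homogeneous (i : Fin N) : theta A i ∈ homogeneous A N 0 1 :=
  Submodule.apply_mem_map₂ _ (MvPolynomial.isHomogeneous_one _ _)
    (by simp [ExteriorAlgebra.exteriorPower])

theorem powerSum_mem_homogeneous (a : ℕ) : powerSum A N a ∈ homogeneous A N a 0 :=
  sum_mem fun i _ => x_pow_mem_homogeneous A i a

theorem fermionicPowerSum_mem_homogeneous (a : ℕ) :
    fermionicPowerSum A N a ∈ homogeneous A N a 1 :=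
  sum_mem fun i _ => by
    simpa using homogeneous_mul A (theta_mem_homogeneous A i) (x_pow_mem_homogeneous A i a)

theorem superPowerSum_mem_homogeneous (Λ : Superpartition) :
    superPowerSum A N Λ ∈ homogeneous A N Λ.degree Λ.sector := by
  have h1 (l : List ℕ) :
      (l.map (fermionicPowerSum A N)).prod ∈ homogeneous A N l.sum l.length := by
    induction l with
    | nil => exact homogeneous_one A N
    | cons a l ih =>
      simpa [add_comm] using homogeneous_mul A (fermionicPowerSum_mem_homogeneous A a) ih
  have h2 (l : List ℕ) : (l.map (powerSum A N)).prod ∈ homogeneous A N l.sum 0 := by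
    induction l with
    | nil => exact homogeneous_one A N
    | cons a l ih => simpa using homogeneous_mul A (powerSum_mem_homogeneous A a) ih
  have h := homogeneous_mul A (h1 Λ.anti) (h2 Λ.symm)
  rwa [add_zero] at h

theorem superPowerSum_mem_symHomogeneous {n m : ℕ} (Λ : SPar n m) :
    superPowerSum A N Λ.1 ∈ symHomogeneous A N n m := by
  refine ⟨(mem_symSuperPoly A).2 fun σ => permute_superPowerSum A σ Λ.1, ?_⟩
  have h := superPowerSum_mem_homogeneous A (N := N) Λ.1
  rwa [Λ.2.1, Λ.2.2] at h

theorem span_range_superPowerSum (K : Type) [Field K] [CharZero K] (N n m : ℕ) :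
    Submodule.span K (Set.range fun Λ : SPar n m => superPowerSum K N Λ.1) =
      symHomogeneous K N n m := by
  refine le_antisymm (Submodule.span_le.2 ?_) fun f hf =>
    letterSumSpan_le_superPowerSumSpan K N (n, m) (symHomogeneous_le_letterSumSpan K N n m hf)
  rintro _ ⟨Λ, rfl⟩
  exact superPowerSum_mem_symHomogeneous K Λ


/-! ### Exponent vectors of superpartitions -/

theorem ofFn_getD_eq_append_replicate {l : List ℕ} (h : l.length ≤ N) :
    List.ofFn (fun i : Fin N => l.getD i 0) = l ++ List.replicate (N - l.length) 0 := by
  refine List.ext_getElem (by simp [h]) fun i h1 h2 => ?_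
  rw [List.getElem_ofFn, List.getElem_append]
  split_ifs with hi
  · simp [hi]
  · simp [not_lt.1 hi]

theorem ofFn_getD_append {l l' : List ℕ} {m : ℕ} (h : l.length = m) :
    List.ofFn (fun i : Fin m => (l ++ l').getD i 0) = l := by
  subst h
  refine List.ext_getElem (by simp) fun i h1 h2 => ?_
  simp [List.getElem?_append_left h2, h2]

namespace Superpartition

/-- The number of parts of a superpartition. -/
def length (Λ : Superpartition) : ℕ := Λ.anti.length + Λ.symm.length

/-- The exponent vector of the monomial in `N` variables attached to a superpartition. -/
def exponent (Λ : Superpartition) (N : ℕ) : Fin N →₀ ℕ :=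
  Finsupp.equivFunOnFinite.symm fun i => (Λ.anti ++ Λ.symm).getD i 0

theorem ofFn_exponent (Λ : Superpartition) (h : Λ.length ≤ N) :
    List.ofFn (Λ.exponent N) =
      Λ.anti ++ (Λ.symm ++ List.replicate (N - Λ.length) 0) := by
  have := ofFn_getD_eq_append_replicate (N := N) (l := Λ.anti ++ Λ.symm)
    (by rw [List.length_append]; exact h)
  rwa [List.length_append, List.append_assoc] at this

theorem ofFn_exponent_castLE (Λ : Superpartition) {m : ℕ} (h : Λ.sector = m) (hm : m ≤ N) :
    List.ofFn (fun i : Fin m => Λ.exponent N (Fin.castLE hm i)) = Λ.anti :=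
  ofFn_getD_append h

theorem degree_exponent (Λ : Superpartition) (h : Λ.length ≤ N) :
    (Λ.exponent N).degree = Λ.degree := by
  rw [Finsupp.degree_eq_sum, ← List.sum_ofFn, ofFn_exponent Λ h]
  simp [degree]

theorem exponent_castLE_strictAnti (Λ : Superpartition) {m : ℕ} (h : Λ.sector = m)
    (hm : m ≤ N) : StrictAnti fun i : Fin m => Λ.exponent N (Fin.castLE hm i) := by
  have := Λ.anti_strict
  rw [← ofFn_exponent_castLE Λ h hm, List.pairwise_ofFn] at this
  exact fun i j hij => this hij

/-- The first `m` exponents are strictly decreasing, so a permutation preserving these positions and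
matching the exponents must fix each of them. This rigidity rules out sign cancellation in
`symMonomial`. -/
theorem eq_of_mapDomain_exponent {Λ Ω : Superpartition} {m : ℕ} (hm : m ≤ N)
    (hΛ : Λ.sector = m) (hΩ : Ω.sector = m) (hΛN : Λ.length ≤ N) (hΩN : Ω.length ≤ N)
    (σ : Equiv.Perm (Fin N)) (hσ : (Λ.exponent N).mapDomain σ = Ω.exponent N)
    (hσm : ∀ i : Fin m, ∃ j : Fin m, σ (Fin.castLE hm i) = Fin.castLE hm j) :
    Λ = Ω ∧ ∀ i : Fin m, σ (Fin.castLE hm i) = Fin.castLE hm i := by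
  have hval (i : Fin N) : Ω.exponent N (σ i) = Λ.exponent N i := by
    rw [← hσ, Finsupp.mapDomain_apply σ.injective]
  choose τ hτ using hσm
  have hτinj : Function.Injective τ := fun i j hij => by
    have := congrArg (Fin.castLE hm) hij
    rw [← hτ, ← hτ] at this
    exact Fin.castLE_injective hm (σ.injective this)
  let τ' : Equiv.Perm (Fin m) := Equiv.ofBijective τ (Finite.injective_iff_bijective.1 hτinj)
  have hτval (i : Fin m) : Ω.exponent N (Fin.castLE hm (τ i)) =
      Λ.exponent N (Fin.castLE hm i) := by rw [← hτ, hval]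
  have hanti : Λ.anti = Ω.anti := by
    have hperm : Λ.anti.Perm Ω.anti := by
      rw [← ofFn_exponent_castLE Λ hΛ hm, ← ofFn_exponent_castLE Ω hΩ hm]
      simp_rw [← hτval]
      exact Equiv.Perm.ofFn_comp_perm τ' fun i => Ω.exponent N (Fin.castLE hm i)
    exact hperm.eq_of_pairwise (fun a b _ _ h h' => absurd h (lt_asymm h')) Λ.anti_strict
      Ω.anti_strict
  have hsymm : Λ.symm = Ω.symm := by
    have hperm : (List.ofFn (Λ.exponent N)).Perm (List.ofFn (Ω.exponent N)) := by
      rw [show (Λ.exponent N : Fin N → ℕ) = Ω.exponent N ∘ σ from funext fun i => (hval i).symm]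
      exact Equiv.Perm.ofFn_comp_perm σ _
    rw [ofFn_exponent Λ hΛN, ofFn_exponent Ω hΩN, hanti, List.perm_append_left_iff] at hperm
    -- The exponent vectors are padded with zeros; discarding zeros recovers the symmetric parts.
    have hfilter (Λ : Superpartition) (k : ℕ) :
        (Λ.symm ++ List.replicate k 0).filter (0 < ·) = Λ.symm := by
      rw [List.filter_append, List.filter_eq_self.2 (by simpa using Λ.symm_pos)]
      simp
    have := hperm.filter (0 < ·)
    rw [hfilter, hfilter] at this
    exact this.eq_of_pairwise (fun a b _ _ h h' => le_antisymm h' h) Λ.symm_weak Ω.symm_weak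
  refine ⟨Superpartition.ext hanti hsymm, fun i => ?_⟩
  have hΛΩ : Λ = Ω := Superpartition.ext hanti hsymm
  subst hΛΩ
  rw [hτ, (exponent_castLE_strictAnti Λ hΛ hm).injective (hτval i)]

/-- Only the last entry can be 0. This possible zero part is why `m > 0` requires `n < N` and not
just `n ≤ N`. -/
theorem length_le_sum_add_one {l : List ℕ} (h : l.Pairwise fun a b => b < a) :
    l.length ≤ l.sum + 1 := by
  induction l with
  | nil => simp
  | cons a l ih =>
    rw [List.pairwise_cons] at h
    have := ih h.2
    cases l with
    | nil => simp
    | cons b l =>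
      have := h.1 b (by simp)
      simp only [List.length_cons, List.sum_cons] at *
      omega

theorem length_le (Λ : Superpartition) {n m : ℕ} (h : Λ.degree = n ∧ Λ.sector = m)
    (hN : (n ≤ N ∧ m = 0) ∨ (n < N ∧ 0 < m)) : Λ.length ≤ N := by
  have h1 := length_le_sum_add_one Λ.anti_strict
  have h2 : Λ.symm.length ≤ Λ.symm.sum := List.length_le_sum_of_one_le _ Λ.symm_pos
  obtain ⟨rfl, rfl⟩ := h
  simp only [degree, sector, length] at *
  omega

end Superpartition

/-! ### Coefficient functionals and independence of symmetrized monomials -/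

/-- The alternating form on `A^N` given by the determinant of the first `m` coordinates. -/
def initialMinor {m : ℕ} (hm : m ≤ N) : (Fin N →₀ A) [⋀^Fin m]→ₗ[A] A :=
  Matrix.detRowAlternating.compLinearMap
    (LinearMap.funLeft A A (Fin.castLE hm) ∘ₗ Finsupp.lcoeFun)

/-- The coefficient of `x ^ b * θ_1 ⋯ θ_m` in a superpolynomial. -/
def superCoeff {m : ℕ} (hm : m ≤ N) (b : Fin N →₀ ℕ) : SuperPoly A N →ₗ[A] A :=
  LinearMap.mul' A A ∘ₗ TensorProduct.map (MvPolynomial.lcoeff A b)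
    (ExteriorAlgebra.liftAlternating (Pi.single m (initialMinor A hm)))

theorem superCoeff_tmul {m : ℕ} (hm : m ≤ N) (a b : Fin N →₀ ℕ) (g : Fin m → Fin N) :
    superCoeff A hm b (MvPolynomial.monomial a (1 : A) ⊗ₜ[A]
      ExteriorAlgebra.ιMulti A m (fun j => Finsupp.single (g j) (1 : A))) =
      (if a = b then 1 else 0) *
        (Matrix.of fun i j : Fin m => if g i = Fin.castLE hm j then (1 : A) else 0).det := by
  classical
  simp only [superCoeff, LinearMap.comp_apply, TensorProduct.map_tmul, LinearMap.mul'_apply,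
    MvPolynomial.lcoeff_apply, MvPolynomial.coeff_monomial,
    ExteriorAlgebra.liftAlternating_apply_ιMulti, Pi.single_eq_same, initialMinor,
    AlternatingMap.compLinearMap_apply]
  congr 1
  change Matrix.detRowAlternating _ = Matrix.detRowAlternating _
  congr 1
  ext i j
  simp [LinearMap.funLeft_apply, Finsupp.single_apply]

/-- The monomial `x ^ Λ * θ_1 ⋯ θ_m` of a superpartition with `m` fermionic parts. -/
def superMonomial {m : ℕ} (hm : m ≤ N) (Λ : Superpartition) : SuperPoly A N :=
  MvPolynomial.monomial (Λ.exponent N) (1 : A) ⊗ₜ[A]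
    ExteriorAlgebra.ιMulti A m (fun j => Finsupp.single (Fin.castLE hm j) (1 : A))

theorem permute_superMonomial {m : ℕ} (hm : m ≤ N) (Λ : Superpartition)
    (σ : Equiv.Perm (Fin N)) : permute A σ (superMonomial A hm Λ) =
      MvPolynomial.monomial ((Λ.exponent N).mapDomain σ) (1 : A) ⊗ₜ[A]
        ExteriorAlgebra.ιMulti A m (fun j => Finsupp.single (σ (Fin.castLE hm j)) (1 : A)) := by
  rw [superMonomial, permute, Algebra.TensorProduct.map_tmul, MvPolynomial.rename_monomial,
    ExteriorAlgebra.map_apply_ιMulti]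
  simp [Function.comp_def, Finsupp.lmapDomain_apply]

/-- The sum of the images of `x ^ Λ * θ_1 ⋯ θ_m` under all permutations of the variables. -/
def symMonomial {m : ℕ} (hm : m ≤ N) (Λ : Superpartition) : SuperPoly A N :=
  ∑ σ : Equiv.Perm (Fin N), permute A σ (superMonomial A hm Λ)

theorem permute_permute (σ τ : Equiv.Perm (Fin N)) (f : SuperPoly A N) :
    permute A σ (permute A τ f) = permute A (σ * τ) f := by
  rw [← AlgHom.comp_apply]
  congr 1
  apply Algebra.TensorProduct.ext
  · ext i
    exact (congrArg _ (permute_x A τ i)).trans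
      ((permute_x A σ (τ i)).trans (permute_x A (σ * τ) i).symm)
  · ext i
    exact (congrArg _ (permute_theta A τ i)).trans
      ((permute_theta A σ (τ i)).trans (permute_theta A (σ * τ) i).symm)

theorem symMonomial_mem {n m : ℕ} (hm : m ≤ N) (Λ : Superpartition) (hN : Λ.length ≤ N)
    (h : Λ.degree = n) : symMonomial A hm Λ ∈ symHomogeneous A N n m := by
  refine ⟨(mem_symSuperPoly A).2 fun τ => ?_, sum_mem fun σ _ => ?_⟩
  · simp only [symMonomial, map_sum, permute_permute]
    exact Equiv.sum_comp (Equiv.mulLeft τ) fun σ => permute A σ (superMonomial A hm Λ)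
  · rw [permute_superMonomial, homogeneous_eq_span]
    refine Submodule.subset_span ⟨_, _, ?_, rfl⟩
    rw [Finsupp.degree_mapDomain, Superpartition.degree_exponent Λ hN, h]

/-- A nonzero determinant has no zero row, so `σ` preserves the first `m` indices. Rigidity then
makes the matrix the identity, and the coefficient is 1 rather than merely a sign. -/
theorem superCoeff_permute {m : ℕ} (hm : m ≤ N) {Λ Ω : Superpartition}
    (hΛ : Λ.sector = m) (hΩ : Ω.sector = m) (hΛN : Λ.length ≤ N) (hΩN : Ω.length ≤ N)
    (σ : Equiv.Perm (Fin N))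
    (h : superCoeff A hm (Ω.exponent N) (permute A σ (superMonomial A hm Λ)) ≠ 0) :
    Λ = Ω ∧ superCoeff A hm (Ω.exponent N) (permute A σ (superMonomial A hm Λ)) = 1 := by
  rw [permute_superMonomial, superCoeff_tmul] at h ⊢
  split_ifs at h ⊢ with hσ
  · rw [one_mul] at h ⊢
    obtain ⟨h1, h2⟩ := Superpartition.eq_of_mapDomain_exponent hm hΛ hΩ hΛN hΩN σ hσ fun i => by
      by_contra! hi
      exact h (Matrix.det_eq_zero_of_row_eq_zero i fun j => by simp [hi j])
    refine ⟨h1, ?_⟩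
    rw [← Matrix.det_one (n := Fin m)]
    congr 1
    ext i j
    simp [h2, Matrix.one_apply]
  · simp at h

theorem superCoeff_symMonomial_of_ne {m : ℕ} (hm : m ≤ N) {Λ Ω : Superpartition}
    (hΛ : Λ.sector = m) (hΩ : Ω.sector = m) (hΛN : Λ.length ≤ N) (hΩN : Ω.length ≤ N)
    (h : Λ ≠ Ω) : superCoeff A hm (Ω.exponent N) (symMonomial A hm Λ) = 0 := by
  rw [symMonomial, map_sum]
  refine Finset.sum_eq_zero fun σ _ => ?_
  by_contra hσ
  exact h (superCoeff_permute A hm hΛ hΩ hΛN hΩN σ hσ).1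

theorem superCoeff_symMonomial_self [CharZero A] {m : ℕ} (hm : m ≤ N) {Λ : Superpartition}
    (hΛ : Λ.sector = m) (hΛN : Λ.length ≤ N) :
    superCoeff A hm (Λ.exponent N) (symMonomial A hm Λ) ≠ 0 := by
  classical
  set c := fun σ : Equiv.Perm (Fin N) =>
    superCoeff A hm (Λ.exponent N) (permute A σ (superMonomial A hm Λ)) with hc
  have h01 (σ) : c σ = if c σ ≠ 0 then 1 else 0 := by
    split_ifs with h
    · exact (superCoeff_permute A hm hΛ hΛ hΛN hΛN σ h).2
    · exact not_not.1 h
  have h1 : c 1 ≠ 0 := by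
    rw [hc]
    simp only [permute_superMonomial, superCoeff_tmul]
    have : (Matrix.of fun i j : Fin m =>
        if (1 : Equiv.Perm (Fin N)) (Fin.castLE hm i) = Fin.castLE hm j then (1 : A) else 0) =
        1 := by
      ext i j
      simp [Matrix.one_apply]
    rw [this]
    simp
  -- All terms are 0 or 1, so the coefficient counts permutations, the identity among them.
  rw [symMonomial, map_sum, Finset.sum_congr rfl fun σ _ => h01 σ, Finset.sum_boole,
    Nat.cast_ne_zero]
  exact Finset.card_ne_zero_of_mem (a := 1) (by simpa using h1)

theorem linearIndependent_symMonomial [IsDomain A] [CharZero A] {n m : ℕ} (hm : m ≤ N)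
    (hN : ∀ Λ : SPar n m, Λ.1.length ≤ N) :
    LinearIndependent A fun Λ : SPar n m => symMonomial A hm Λ.1 := by
  rw [linearIndependent_iff']
  intro s c hs Ω hΩ
  have h := congrArg (superCoeff A hm (Ω.1.exponent N)) hs
  rw [map_sum, Finset.sum_eq_single_of_mem Ω hΩ] at h
  · rw [map_smul, map_zero, smul_eq_mul, mul_eq_zero] at h
    exact h.resolve_right (superCoeff_symMonomial_self A hm Ω.2.2 (hN Ω))
  · intro Λ _ hΛ
    rw [map_smul, superCoeff_symMonomial_of_ne A hm Λ.2.2 Ω.2.2 (hN Λ) (hN Ω)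
      (fun h => hΛ (Subtype.ext h)), smul_zero]

/-! ### Independence of `p_Λ` by dimension count -/

theorem homogeneous_fg (N n m : ℕ) : (homogeneous A N n m).FG :=
  (MvPolynomial.homogeneousSubmodule_fg (Fin N) A n).map₂ _ (Module.Finite.iff_fg.1 inferInstance)

theorem linearIndependent_superPowerSum (K : Type) [Field K] [CharZero K] {N n m : ℕ}
    (hN : (n ≤ N ∧ m = 0) ∨ (n < N ∧ 0 < m)) :
    LinearIndependent K fun Λ : SPar n m => superPowerSum K N Λ.1 := by
  have hlen (Λ : SPar n m) : Λ.1.length ≤ N := Λ.1.length_le Λ.2 hN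
  rcases isEmpty_or_nonempty (SPar n m) with _ | ⟨⟨Λ₀⟩⟩
  · exact linearIndependent_empty_type
  have hm : m ≤ N := by
    rw [← Λ₀.2.2]
    exact (Nat.le_add_right _ _).trans (hlen Λ₀)
  have : Module.Finite K (homogeneous K N n m) := Module.Finite.iff_fg.2 (homogeneous_fg K N n m)
  have : Module.Finite K (symHomogeneous K N n m) :=
    Submodule.finiteDimensional_of_le inf_le_right
  let v (Λ : SPar n m) : symHomogeneous K N n m :=
    ⟨symMonomial K hm Λ.1, symMonomial_mem K hm Λ.1 (hlen Λ) Λ.2.1⟩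
  have hv : LinearIndependent K v :=
    LinearIndependent.of_comp (Submodule.subtype _) (linearIndependent_symMonomial K hm hlen)
  -- Finiteness comes for free: the index set of an independent family in a finite-dimensional
  -- space.
  have : Finite (SPar n m) := hv.finite
  have := Fintype.ofFinite (SPar n m)
  rw [linearIndependent_iff_card_le_finrank_span, Set.finrank, span_range_superPowerSum]
  exact hv.fintype_card_le_finrank


/-! ### Passage to infinitely many variables -/

theorem restrict_x_castSucc (i : Fin N) : restrict A N (x A i.castSucc) = x A i := by
  simp [restrict, x]

theorem restrict_x_last (N : ℕ) : restrict A N (x A (Fin.last N)) = 0 := by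
  simp [restrict, x]

theorem restrict_theta_castSucc (i : Fin N) :
    restrict A N (theta A i.castSucc) = theta A i := by
  simp [restrict, theta]

theorem restrict_theta_last (N : ℕ) : restrict A N (theta A (Fin.last N)) = 0 := by
  simp [restrict, theta]

/-- For `a = 0` this would fail, as the last variable still contributes 1. In the fermionic sum the
factor `θ` kills that term. -/
theorem restrict_powerSum (N : ℕ) {a : ℕ} (ha : 0 < a) :
    restrict A N (powerSum A (N + 1) a) = powerSum A N a := by
  simp [powerSum, Fin.sum_univ_castSucc, restrict_x_castSucc, restrict_x_last, ha.ne']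

theorem restrict_fermionicPowerSum (N a : ℕ) :
    restrict A N (fermionicPowerSum A (N + 1) a) = fermionicPowerSum A N a := by
  simp [fermionicPowerSum, Fin.sum_univ_castSucc, restrict_x_castSucc, restrict_theta_castSucc,
    restrict_theta_last]

theorem restrict_superPowerSum (N : ℕ) (Λ : Superpartition) :
    restrict A N (superPowerSum A (N + 1) Λ) = superPowerSum A N Λ := by
  simp only [superPowerSum, map_mul, map_list_prod, List.map_map]
  congr 2
  · exact List.map_congr_left fun a _ => restrict_fermionicPowerSum A N a
  · exact List.map_congr_left fun a ha => restrict_powerSum A N (Λ.symm_pos a ha)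

theorem superPowerSumInf_mem {n m : ℕ} (Λ : SPar n m) :
    superPowerSumInf A Λ.1 ∈ symFunHomogeneous A n m :=
  ⟨fun _ => superPowerSum_mem_symHomogeneous A Λ, fun N => restrict_superPowerSum A N Λ.1⟩

section Field

variable (K : Type) [Field K] [CharZero K] (n m : ℕ)

theorem linearIndependent_superPowerSum_of_lt {N : ℕ} (h : n < N) :
    LinearIndependent K fun Λ : SPar n m => superPowerSum K N Λ.1 := by
  apply linearIndependent_superPowerSum
  omega

theorem linearIndependent_superPowerSumInf_homogeneous :
    LinearIndependent K fun Λ : SPar n m => superPowerSumInf K Λ.1 :=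
  LinearIndependent.of_comp (LinearMap.proj (n + 1))
    (linearIndependent_superPowerSum_of_lt K n m (Nat.lt_succ_self n))

theorem span_range_superPowerSumInf_homogeneous :
    Submodule.span K (Set.range fun Λ : SPar n m => superPowerSumInf K Λ.1) =
      symFunHomogeneous K n m := by
  refine le_antisymm (Submodule.span_le.2 ?_) fun f hf => ?_
  · rintro _ ⟨Λ, rfl⟩
    exact superPowerSumInf_mem K Λ
  have hrep (N : ℕ) : ∃ c : SPar n m →₀ K,
      Finsupp.linearCombination K (fun Λ : SPar n m => superPowerSum K N Λ.1) c = f N := by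
    refine (Finsupp.mem_span_range_iff_exists_finsupp (R := K)
      (v := fun Λ : SPar n m => superPowerSum K N Λ.1)).1 ?_
    rw [span_range_superPowerSum]
    exact hf.1 N
  have hrestrict (N : ℕ) (c : SPar n m →₀ K) : restrict K N
      (Finsupp.linearCombination K (fun Λ : SPar n m => superPowerSum K (N + 1) Λ.1) c) =
      Finsupp.linearCombination K (fun Λ : SPar n m => superPowerSum K N Λ.1) c := by
    simp [Finsupp.linearCombination_apply, Finsupp.sum, map_sum, restrict_superPowerSum]
  -- From `n + 1` variables on, the `p_Λ` are independent whatever `m` is, so coefficients are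
  -- unique.
  obtain ⟨c, hc⟩ := hrep (n + 1)
  have hup (k : ℕ) : Finsupp.linearCombination K
      (fun Λ : SPar n m => superPowerSum K (n + 1 + k) Λ.1) c = f (n + 1 + k) := by
    induction k with
    | zero => exact hc
    | succ k ih =>
      obtain ⟨d, hd⟩ := hrep (n + 1 + k + 1)
      have h : Finsupp.linearCombination K
          (fun Λ : SPar n m => superPowerSum K (n + 1 + k) Λ.1) d = f (n + 1 + k) := by
        rw [← hrestrict, hd, hf.2]
      -- The representation `d` in one more variable restricts to one of `f (n + 1 + k)`, hence
      -- agrees with `c`.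
      have hcd : c = d :=
        linearIndependent_superPowerSum_of_lt K n m (by omega) (ih.trans h.symm)
      rw [hcd]
      exact hd
  -- For few variables uniqueness may fail, but the identity descends by restriction.
  have hdown (N k : ℕ) (h : Finsupp.linearCombination K
      (fun Λ : SPar n m => superPowerSum K (N + k) Λ.1) c = f (N + k)) :
      Finsupp.linearCombination K (fun Λ : SPar n m => superPowerSum K N Λ.1) c = f N := by
    induction k with
    | zero => exact h
    | succ k ih =>
      refine ih ?_
      rw [← hrestrict, ← hf.2]
      exact congrArg _ h
  refine Finsupp.mem_span_range_iff_exists_finsupp.2 ⟨c, ?_⟩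
  funext N
  have h := hdown N (n + 1) (by rw [add_comm N]; exact hup N)
  rw [← h, Finsupp.linearCombination_apply]
  simp [Finsupp.sum, superPowerSumInf]

theorem span_range_superPowerSumInf :
    Submodule.span K (Set.range (superPowerSumInf K)) = (symFun K).toSubmodule := by
  have h : Set.range (superPowerSumInf K) = ⋃ d : ℕ × ℕ,
      Set.range fun Λ : SPar d.1 d.2 => superPowerSumInf K Λ.1 := by
    ext f
    simp only [Set.mem_range, Set.mem_iUnion]
    exact ⟨fun ⟨Λ, h⟩ => ⟨(Λ.degree, Λ.sector), ⟨Λ, rfl, rfl⟩, h⟩, fun ⟨_, Λ, h⟩ => ⟨Λ.1, h⟩⟩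
  rw [h, Submodule.span_iUnion]
  simp_rw [span_range_superPowerSumInf_homogeneous]
  rw [symFun, Submodule.toSubalgebra_toSubmodule]

end Field

/-! ### Separating the bidegrees -/

/-- The projection of the superpolynomials to those of degree `(n|m)`. -/
def homogeneousProj (N n m : ℕ) : SuperPoly A N →ₗ[A] SuperPoly A N :=
  TensorProduct.map (MvPolynomial.homogeneousComponent n)
    (ExteriorAlgebra.liftAlternating (Pi.single m (ExteriorAlgebra.ιMulti A m)))

theorem homogeneousProj_of_mem {n m : ℕ} (n' m' : ℕ) {f : SuperPoly A N}
    (hf : f ∈ homogeneous A N n m) :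
    homogeneousProj A N n' m' f = if n = n' ∧ m = m' then f else 0 := by
  rw [homogeneous_eq_span] at hf
  induction hf using Submodule.span_induction with
  | mem f hf =>
    obtain ⟨a, g, rfl, rfl⟩ := hf
    rw [homogeneousProj, TensorProduct.map_tmul, MvPolynomial.homogeneousComponent_of_mem
      (MvPolynomial.isHomogeneous_monomial 1 rfl), ExteriorAlgebra.liftAlternating_apply_ιMulti]
    by_cases hm : m = m'
    · subst hm
      by_cases hn : a.degree = n'
      · simp [hn]
      · simp [hn, Ne.symm hn]
    · simp [hm]
  | zero => simp
  | add f g _ _ hf hg => rw [map_add, hf, hg]; split_ifs <;> simp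
  | smul c f _ hf => rw [map_smul, hf]; split_ifs <;> simp

theorem linearIndependent_superPowerSumInf (K : Type) [Field K] [CharZero K] :
    LinearIndependent K (superPowerSumInf K) := by
  classical
  rw [linearIndependent_iff']
  intro s c hs Λ hΛ
  -- In `Λ.degree + 1` variables, projecting to the bidegree of `Λ` keeps only the terms of that
  -- bidegree, which are already known to be independent there.
  have h := congrArg (homogeneousProj K (Λ.degree + 1) Λ.degree Λ.sector)
    (congrFun hs (Λ.degree + 1))
  simp only [Finset.sum_apply, Pi.smul_apply, superPowerSumInf, map_sum, map_smul,
    homogeneousProj_of_mem K _ _ (superPowerSum_mem_homogeneous K _), smul_ite, smul_zero,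
    Pi.zero_apply, map_zero] at h
  rw [← Finset.sum_filter, ← Finset.sum_subtype_eq_sum_filter] at h
  exact linearIndependent_iff'.1 (linearIndependent_superPowerSum_of_lt K Λ.degree Λ.sector
    (Nat.lt_succ_self _)) _ (fun Ω => c Ω.1) h ⟨Λ, rfl, rfl⟩ (Finset.mem_subtype.2 hΛ)

end SymSuper

end

theorem mainTheorem6 :
    (∀ N n m : ℕ, (n ≤ N ∧ m = 0) ∨ (n < N ∧ 0 < m) →
      LinearIndependent ℚ (fun Λ : SymSuper.SPar n m => SymSuper.superPowerSum ℚ N Λ.1) ∧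
      Submodule.span ℚ (Set.range fun Λ : SymSuper.SPar n m => SymSuper.superPowerSum ℚ N Λ.1) =
        SymSuper.symHomogeneous ℚ N n m) ∧
    (∀ n m : ℕ,
      LinearIndependent ℚ (fun Λ : SymSuper.SPar n m => SymSuper.superPowerSumInf ℚ Λ.1) ∧
      Submodule.span ℚ (Set.range fun Λ : SymSuper.SPar n m => SymSuper.superPowerSumInf ℚ Λ.1) =
        SymSuper.symFunHomogeneous ℚ n m) ∧
    LinearIndependent ℚ (SymSuper.superPowerSumInf ℚ) ∧
    Submodule.span ℚ (Set.range (SymSuper.superPowerSumInf ℚ)) =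
      (SymSuper.symFun ℚ).toSubmodule := by
  refine ⟨fun N n m h => ⟨SymSuper.linearIndependent_superPowerSum ℚ h,
      SymSuper.span_range_superPowerSum ℚ N n m⟩,
    fun n m => ⟨SymSuper.linearIndependent_superPowerSumInf_homogeneous ℚ n m,
      SymSuper.span_range_superPowerSumInf_homogeneous ℚ n m⟩,
    SymSuper.linearIndependent_superPowerSumInf ℚ, SymSuper.span_range_superPowerSumInf ℚ⟩
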